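/- Let $b,\gamma:[0,\infty)\to(0,1]$ be continuous with $b(x)+\gamma(x)\le 1$ for all $x$, and let $\beta$ be a probability density on $[0,\infty)$ with support $(0,a+1)$, where $a\le\infty$ (that is, $\beta>0$ almost everywhere on $(0,a+1)$ and $\beta=0$ almost everywhere outside it). Let $(X_n)_{n\ge 0}$ be the Markov chain on $[0,\infty)$ with one-step transition kernel $$P(x,\mathrm dy)=\begin{cases}\beta(y)\,\mathrm dy, & x=0,\\ \gamma(x)\,\delta_{0}(\mathrm dy)+b(x)\,\delta_{x+1}(\mathrm dy)+(1-\gamma(x)-b(x))\,\delta_{x}(\mathrm dy), & x>0.\end{cases}$$ An irreducibility measure is a $\sigma$-finite measure $\varphi$ such that $\sum_{n\ge1}P^n(x,A)>0$ for all $x$ whenever $\varphi(A)>0$; it is maximal if every irreducibility measure is absolutely continuous with respect to it. The chain is called ergodic if, for a maximal irreducibility measure $\psi$, (i) it is Harris recurrent: $\mathbb P_x\big(\sum_{n\ge1}\mathbf 1_{\{X_n\in A\}}=\infty\big)=1$ for all $x$ and all measurable $A$ with $\psi(A)>0$; and (ii) there is a petite set $C$ with $\psi(C)>0$ and $\sup_{x\in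 C}\mathbb E_x\tau_C^+<\infty$, where $\tau_C^+=\inf\{n\ge1:X_n\in C\}$. Here a measurable set $C$ is petite if there are a probability distribution $(a_n)_{n\ge0}$ and a non-zero measure $\nu$ with $\sum_{n\ge0}a_nP^n(x,B)\ge\nu(B)$ for all $x\in C$ and all measurable $B$. (1) If there exists $x_1>0$ such that $$\int_{x_1}^{\infty}\frac{\beta(y)}{\sup_{u\ge y}\gamma(u)}\,\mathrm dy=\infty,$$ then $(X_n)$ is not ergodic. (2) If there exist $x_1>0$ and $c>0$ such that $$\int_{x_1}^{\infty}\frac{c\,b(y)+1}{\gamma(y)}\,\beta(y)\,\mathrm dy<\infty$$ and $$b(x)\left(c\left(\frac{b(x+1)}{\gamma(x+1)}-\frac{b(x)}{\gamma(x)}\right)-\frac1{\gamma(x)}+\frac1{\gamma(x+1)}-c\right)\le 0\qquad\text{for all } x>x_1,$$ then $(X_n)$ is ergodic. -/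

import Mathlib

open MeasureTheory ProbabilityTheory
open scoped ENNReal NNReal

noncomputable section

namespace MarkovErgodicity

section General

variable {X : Type*} [MeasurableSpace X]

/-- The law `ℙ_x`, on the space of trajectories `ℕ → X`, of the homogeneous Markov chain with
one-step transition kernel `P` started at `x` (the Ionescu-Tulcea measure). -/
def pathLaw (P : Kernel X X) [IsMarkovKernel P] (x : X) : Measure (ℕ → X) :=
  Kernel.traj (X := fun _ : ℕ => X)
    (fun n => P.comap
      (fun h : (i : Finset.Iic n) → X => h ⟨n, Finset.mem_Iic.2 le_rfl⟩)
      (measurable_pi_apply _))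
    0 (fun _ => x)

/-- The first return time `τ_A⁺ = inf {n ≥ 1 : X_n ∈ A}` of a trajectory, with `inf ∅ = ∞`. -/
def returnTime (A : Set X) (ω : ℕ → X) : ℝ≥0∞ :=
  ⨅ (n : ℕ) (_ : 1 ≤ n ∧ ω n ∈ A), (n : ℝ≥0∞)

/-- The expected return time `𝔼_x τ_A⁺`. -/
def meanReturnTime (P : Kernel X X) [IsMarkovKernel P] (A : Set X) (x : X) : ℝ≥0∞ :=
  ∫⁻ ω, returnTime A ω ∂(pathLaw P x)

/-- `ψ` is an irreducibility measure: it is `σ`-finite and `∑_{n ≥ 1} Pⁿ(x, A) > 0` for all `x`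
whenever `ψ(A) > 0`. -/
def IsIrreducibilityMeasure (P : Kernel X X) (ψ : Measure X) : Prop :=
  SigmaFinite ψ ∧
    ∀ A : Set X, MeasurableSet A → 0 < ψ A → ∀ x : X, 0 < ∑' n : ℕ, (P ^ (n + 1)) x A

/-- `ψ` is a maximal irreducibility measure: it is an irreducibility measure that dominates
every irreducibility measure. -/
def IsMaximalIrreducibilityMeasure (P : Kernel X X) (ψ : Measure X) : Prop :=
  IsIrreducibilityMeasure P ψ ∧ ∀ φ : Measure X, IsIrreducibilityMeasure P φ → φ ≪ ψ

/-- Harris recurrence: every `A` with `ψ(A) > 0` is visited infinitely often, `ℙ_x`-almost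
surely, for every starting point `x`. -/
def IsHarrisRecurrent (P : Kernel X X) [IsMarkovKernel P] (ψ : Measure X) : Prop :=
  ∀ A : Set X, MeasurableSet A → 0 < ψ A → ∀ x : X,
    ∀ᵐ ω ∂(pathLaw P x), (∑' n : ℕ, A.indicator (fun _ => (1 : ℝ≥0∞)) (ω (n + 1))) = ∞

/-- `C` is petite: for some probability distribution `a` on `ℕ` and some non-trivial measure `ν`,
`∑ₙ a(n) Pⁿ(x, B) ≥ ν(B)` for all `x ∈ C` and all measurable `B`. -/
def IsPetite (P : Kernel X X) (C : Set X) : Prop :=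
  MeasurableSet C ∧ ∃ (a : PMF ℕ) (ν : Measure X), ν ≠ 0 ∧
    ∀ x ∈ C, ∀ B : Set X, MeasurableSet B → ν B ≤ ∑' n : ℕ, a n * (P ^ n) x B

/-- The chain with transition kernel `P` is ergodic: with respect to a maximal irreducibility
measure `ψ`, it is Harris recurrent and there is a petite set `C` with `ψ(C) > 0` and
`sup_{x ∈ C} 𝔼_x τ_C⁺ < ∞`. (All maximal irreducibility measures have the same null sets.) -/
def IsErgodic (P : Kernel X X) [IsMarkovKernel P] : Prop :=
  ∃ ψ : Measure X, IsMaximalIrreducibilityMeasure P ψ ∧ IsHarrisRecurrent P ψ ∧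
    ∃ C : Set X, IsPetite P C ∧ 0 < ψ C ∧ (⨆ x ∈ C, meanReturnTime P C x) < ∞

end General

/-- Lebesgue measure on `ℝ⁺ = [0, ∞)`. -/
def lebesgue : Measure ℝ≥0 := (volume : Measure ℝ).comap ((↑) : ℝ≥0 → ℝ)

/-- The data of the chain: continuous functions `0 < b ≤ 1` and `0 < γ ≤ 1` on `ℝ⁺` with
`b + γ ≤ 1`, and a probability density `β` on `ℝ⁺` with support `(0, a + 1)`, `a ≤ ∞`
(as usual for densities, the support is understood up to Lebesgue-null sets). -/
structure ImmigrationChain where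
  b : ℝ≥0 → ℝ
  γ : ℝ≥0 → ℝ
  β : ℝ≥0 → ℝ
  a : EReal
  continuous_b : Continuous b
  continuous_γ : Continuous γ
  b_pos : ∀ x, 0 < b x
  γ_pos : ∀ x, 0 < γ x
  b_add_γ_le_one : ∀ x, b x + γ x ≤ 1
  measurable_β : Measurable β
  β_nonneg : ∀ y, 0 ≤ β y
  lintegral_β : ∫⁻ y, ENNReal.ofReal (β y) ∂lebesgue = 1
  support_β : ∀ᵐ y ∂lebesgue, 0 < β y ↔ 0 < y ∧ ((y : ℝ) : EReal) < a + 1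

namespace ImmigrationChain

/-- The one-step transition kernel: `P(0, dy) = β(y) dy` and
`P(x, dy) = γ(x) δ_0(dy) + b(x) δ_{x+1}(dy) + (1 - γ(x) - b(x)) δ_x(dy)` for `x > 0`. -/
def kernel (M : ImmigrationChain) : Kernel ℝ≥0 ℝ≥0 where
  toFun x :=
    if x = 0 then lebesgue.withDensity (fun y => ENNReal.ofReal (M.β y))
    else ENNReal.ofReal (M.γ x) • Measure.dirac 0
      + ENNReal.ofReal (M.b x) • Measure.dirac (x + 1)
      + ENNReal.ofReal (1 - M.γ x - M.b x) • Measure.dirac x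
  measurable' := by
    refine Measurable.ite (measurableSet_singleton 0) measurable_const ?_
    refine Measure.measurable_of_measurable_coe _ fun s hs => ?_
    have hγ : Measurable M.γ := M.continuous_γ.measurable
    have hb : Measurable M.b := M.continuous_b.measurable
    have h1 : Measurable fun x : ℝ≥0 => (Measure.dirac (x + 1) : Measure ℝ≥0) s :=
      (Measure.measurable_coe hs).comp (Measure.measurable_dirac.comp (measurable_id.add_const 1))
    have h2 : Measurable fun x : ℝ≥0 => (Measure.dirac x : Measure ℝ≥0) s :=
      (Measure.measurable_coe hs).comp Measure.measurable_dirac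
    simp only [Measure.add_apply, Measure.smul_apply, smul_eq_mul]
    fun_prop

instance (M : ImmigrationChain) : IsMarkovKernel M.kernel where
  isProbabilityMeasure x := by
    constructor
    change (if x = 0 then _ else _ : Measure ℝ≥0) Set.univ = 1
    split_ifs with h
    · simpa using M.lintegral_β
    · have h1 := M.γ_pos x
      have h2 := M.b_pos x
      have h3 := M.b_add_γ_le_one x
      simp only [Measure.add_apply, Measure.smul_apply, smul_eq_mul, measure_univ, mul_one]
      rw [← ENNReal.ofReal_add h1.le h2.le, ← ENNReal.ofReal_add (by linarith) (by linarith)]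
      simp

end ImmigrationChain

end MarkovErgodicity

end

/-! The state `0` is an atom which every point reaches, so both parts come down to whether the
expected return time from `0` to `0` is finite. For any `A`, the expected return time is handled as
the potential series `tabooMean` of the kernel killed on `A`; it lies below every solution of `1 +
taboo P A U ≤ U` (`tabooMean_le_of_drift`), and `meanReturnTime_eq_tabooMean` links it to the
trajectory space.

Part (1): ergodicity forces a finite mean return time at the atom (`tabooMean_atom_ne_top`). But
from `y > 0` the chain stays above `y` until it drops to `0`, with probability at most `sup_{u ≥ y}
γ(u)` at each step, so the mean hitting time is at least the reciprocal of this supremum.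
Integrating against `β` makes the return time from `0` infinite.

Part (2): with `v = (c b + 1) / γ`, the second hypothesis is the Foster-Lyapunov inequality for `v`
beyond `x₁`. Adding a constant repairs it on the compact set `[0, x₁]`, and the first hypothesis
makes the function integrable against `β`. Hence all mean hitting times of `0` are finite, and
`isErgodic_of_atom` yields Harris recurrence, with `{0}` as petite set. -/

namespace MarkovErgodicity

/-! ### Iterates of a kernel. -/

section Powers

variable {X : Type*} [MeasurableSpace X] (P : Kernel X X)

lemma lintegral_pow_zero (x : X) {f : X → ℝ≥0∞} (hf : Measurable f) :
    ∫⁻ y, f y ∂(P ^ 0) x = f x := by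
  rw [pow_zero]
  change ∫⁻ y, f y ∂(Kernel.id x) = f x
  rw [Kernel.id_apply, lintegral_dirac' x hf]

lemma lintegral_pow_succ (n : ℕ) (x : X) {f : X → ℝ≥0∞} (hf : Measurable f) :
    ∫⁻ y, f y ∂(P ^ (n + 1)) x = ∫⁻ y, ∫⁻ z, f z ∂P y ∂(P ^ n) x := by
  rw [pow_succ']
  exact Kernel.lintegral_comp _ _ _ hf

lemma pow_apply_univ [IsMarkovKernel P] (n : ℕ) (x : X) : (P ^ n) x Set.univ = 1 := by
  induction n with
  | zero => simpa using lintegral_pow_zero P x (f := fun _ => 1) measurable_const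
  | succ n ih => simpa [ih] using lintegral_pow_succ P n x (f := fun _ => 1) measurable_const

instance [IsMarkovKernel P] (n : ℕ) : IsMarkovKernel (P ^ n) :=
  ⟨fun x => ⟨pow_apply_univ P n x⟩⟩

end Powers

/-! ### The kernel killed on a set, and mean return times. -/

section Taboo

variable {X : Type*} [MeasurableSpace X]

/-- The taboo operator `f ↦ P (1_{Aᶜ} f)` of the chain killed on entering `A`. -/
noncomputable def taboo (P : Kernel X X) (A : Set X) (f : X → ℝ≥0∞) (x : X) : ℝ≥0∞ :=
  ∫⁻ y in Aᶜ, f y ∂P x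

/-- The sum `∑ₙ (taboo P A)ⁿ 1`, which is the expected return time to `A`. -/
noncomputable def tabooMean (P : Kernel X X) (A : Set X) (x : X) : ℝ≥0∞ :=
  ∑' n : ℕ, ((taboo P A)^[n] 1) x

variable {P : Kernel X X} [IsMarkovKernel P] {A : Set X}

lemma measurable_taboo (hA : MeasurableSet A) {f : X → ℝ≥0∞} (hf : Measurable f) :
    Measurable (taboo P A f) :=
  hf.setLIntegral_kernel hA.compl

lemma measurable_taboo_iterate (hA : MeasurableSet A) {f : X → ℝ≥0∞} (hf : Measurable f) (n : ℕ) :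
    Measurable ((taboo P A)^[n] f) := by
  induction n with
  | zero => exact hf
  | succ n ih => rw [Function.iterate_succ_apply']; exact measurable_taboo hA ih

lemma measurable_tabooMean (hA : MeasurableSet A) : Measurable (tabooMean P A) := by
  unfold tabooMean
  exact Measurable.tsum fun n => measurable_taboo_iterate hA measurable_one n

omit [IsMarkovKernel P] in
lemma taboo_mono {f g : X → ℝ≥0∞} (h : f ≤ g) : taboo P A f ≤ taboo P A g :=
  fun _ => lintegral_mono h

omit [IsMarkovKernel P] in
lemma taboo_le_lintegral (f : X → ℝ≥0∞) (x : X) : taboo P A f x ≤ ∫⁻ y, f y ∂P x :=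
  setLIntegral_le_lintegral _ _

lemma taboo_one_le_one : taboo P A 1 ≤ 1 := fun x => by
  refine (taboo_le_lintegral 1 x).trans ?_
  simp

lemma antitone_taboo_iterate :
    Antitone fun n => (taboo P A)^[n] (1 : X → ℝ≥0∞) := by
  refine antitone_nat_of_succ_le fun n => ?_
  rw [Function.iterate_succ_apply]
  exact (Monotone.iterate (fun _ _ h => taboo_mono h) n) taboo_one_le_one

lemma tabooMean_eq (hA : MeasurableSet A) (x : X) :
    tabooMean P A x = 1 + taboo P A (tabooMean P A) x := by
  have h : taboo P A (tabooMean P A) x = ∑' n : ℕ, ((taboo P A)^[n + 1] 1) x := by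
    simp_rw [Function.iterate_succ_apply']
    exact lintegral_tsum fun n => (measurable_taboo_iterate hA measurable_one n).aemeasurable
  rw [h, tabooMean, tsum_eq_zero_add' ENNReal.summable]
  simp

/-- The expected return time is the least non-negative solution of `1 + taboo P A U ≤ U`. -/
lemma tabooMean_le_of_drift (hA : MeasurableSet A) {U : X → ℝ≥0∞}
    (h : ∀ x, 1 + taboo P A U x ≤ U x) (x : X) : tabooMean P A x ≤ U x := by
  have key : ∀ n : ℕ, ∀ x, ∑ k ∈ Finset.range n, ((taboo P A)^[k] 1) x ≤ U x := by
    intro n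
    induction n with
    | zero => simp
    | succ n ih =>
      intro x
      rw [Finset.sum_range_succ']
      simp_rw [Function.iterate_succ_apply']
      have : ∑ k ∈ Finset.range n, taboo P A ((taboo P A)^[k] 1) x
          = taboo P A (fun y => ∑ k ∈ Finset.range n, ((taboo P A)^[k] 1) y) x :=
        (lintegral_finsetSum _ fun k _ => measurable_taboo_iterate hA measurable_one k).symm
      rw [this, add_comm]
      exact (add_le_add le_rfl (taboo_mono (fun y => ih y) x)).trans (h x)
  unfold tabooMean
  rw [ENNReal.tsum_eq_iSup_nat]
  exact iSup_le fun n => key n x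

/-- Avoiding `A` during times `1, ..., n + 1` and being in `A` at time `n + 1` are disjoint events.
-/
lemma taboo_iterate_add_pow_le (hA : MeasurableSet A) (n : ℕ) (x : X) :
    ((taboo P A)^[n + 1] 1) x + (P ^ (n + 1)) x A ≤ 1 := by
  induction n generalizing x with
  | zero =>
    simp only [zero_add, Function.iterate_one, pow_one, taboo, Pi.one_apply, lintegral_one,
      Measure.restrict_apply MeasurableSet.univ, Set.univ_inter]
    rw [add_comm, measure_add_measure_compl hA, measure_univ]
  | succ n ih =>
    rw [Function.iterate_succ_apply', add_comm (n + 1) 1,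
      Kernel.pow_add_apply_eq_lintegral _ _ _ _ hA, pow_one]
    refine (add_le_add (taboo_le_lintegral _ x) le_rfl).trans ?_
    rw [← lintegral_add_left (measurable_taboo_iterate hA measurable_one _)]
    exact (lintegral_mono ih).trans (by simp)

end Taboo

/-! ### From trajectories to kernel iterates. -/

section PathLaw

variable {X : Type*} [MeasurableSpace X] (P : Kernel X X) [IsMarkovKernel P]

instance (x : X) : IsProbabilityMeasure (pathLaw P x) := by
  unfold pathLaw; infer_instance

/-- The Markov property at time `n`: `F` is an arbitrary function of the past. -/
lemma lintegral_pathLaw_succ (x : X) (n : ℕ) {F : (Finset.Iic n → X) → ℝ≥0∞} (hF : Measurable F)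
    {f : X → ℝ≥0∞} (hf : Measurable f) :
    ∫⁻ ω, F (fun i => ω i) * f (ω (n + 1)) ∂pathLaw P x
      = ∫⁻ ω, F (fun i => ω i) * (∫⁻ y, f y ∂P (ω n)) ∂pathLaw P x := by
  set κ : (n : ℕ) → Kernel (Finset.Iic n → X) X := fun n => P.comap
      (fun h : (i : Finset.Iic n) → X => h ⟨n, Finset.mem_Iic.2 le_rfl⟩)
      (measurable_pi_apply _) with hκ
  have hp : pathLaw P x = Kernel.traj (X := fun _ : ℕ => X) κ 0 (fun _ => x) := rfl
  have h1 := Kernel.partialTraj_compProd_eq_map_traj (X := fun _ : ℕ => X) (κ := κ)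
    (Nat.zero_le n) (x₀ := fun _ => x)
  have hG : Measurable fun p : (Finset.Iic n → X) × X => F p.1 * f p.2 := by fun_prop
  have h2 : ∫⁻ ω, F (fun i => ω i) * f (ω (n + 1)) ∂pathLaw P x
      = ∫⁻ p, F p.1 * f p.2 ∂((pathLaw P x).map
        (fun ω => (Preorder.frestrictLe (π := fun _ => X) n ω, ω (n + 1)))) := by
    rw [lintegral_map hG (by fun_prop)]
    rfl
  rw [h2, hp, ← h1, Measure.lintegral_compProd hG]
  simp_rw [lintegral_const_mul _ hf]
  rw [← Kernel.traj_map_frestrictLe, Kernel.map_apply _ (by fun_prop), lintegral_map _ (by fun_prop)]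
  · rfl
  · have : Measurable fun h => ∫⁻ y, f y ∂κ n h := hf.lintegral_kernel
    exact hF.mul this

lemma lintegral_pathLaw_eval (x : X) (n : ℕ) {f : X → ℝ≥0∞} (hf : Measurable f) :
    ∫⁻ ω, f (ω n) ∂pathLaw P x = ∫⁻ y, f y ∂(P ^ n) x := by
  induction n generalizing f with
  | zero =>
    have h := Kernel.traj_map_frestrictLe (X := fun _ : ℕ => X) (κ := fun n => P.comap
      (fun h : (i : Finset.Iic n) → X => h ⟨n, Finset.mem_Iic.2 le_rfl⟩)
      (measurable_pi_apply _)) 0 0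
    rw [Kernel.partialTraj_self] at h
    have hg : Measurable fun y : Finset.Iic 0 → X => f (y ⟨0, by simp⟩) := by fun_prop
    have h2 : ∫⁻ ω, f (ω 0) ∂pathLaw P x
        = ∫⁻ y, f (y ⟨0, by simp⟩) ∂((Kernel.id : Kernel (Finset.Iic 0 → X) _) (fun _ => x)) := by
      rw [← h, Kernel.map_apply _ (Preorder.measurable_frestrictLe 0), lintegral_map hg (by fun_prop)]
      rfl
    rw [lintegral_pow_zero P x hf, h2, Kernel.id_apply, lintegral_dirac' _ hg]
  | succ n ih =>
    have h := lintegral_pathLaw_succ P x n (F := fun _ => 1) measurable_const hf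
    simp only [one_mul] at h
    rw [h, ih hf.lintegral_kernel, lintegral_pow_succ P n x hf]

variable {A : Set X}

lemma measurableSet_avoid (hA : MeasurableSet A) (N m : ℕ) :
    MeasurableSet {ω : ℕ → X | ∀ i, N < i → i ≤ N + m → ω i ∉ A} := by
  simp only [Set.ofPred_forall]
  exact MeasurableSet.iInter fun i => MeasurableSet.iInter fun _ => MeasurableSet.iInter fun _ =>
    hA.compl.preimage (measurable_pi_apply i)

/-- Induction on `m`, peeling off the last step: conditioning on the past replaces `f` by `taboo P A
f`. Time `N` itself is unconstrained, so `N = 0` matches a return time, which ignores the starting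
point. -/
lemma lintegral_pathLaw_avoid (hA : MeasurableSet A) (x : X) (N m : ℕ) {f : X → ℝ≥0∞}
    (hf : Measurable f) :
    ∫⁻ ω, {ω : ℕ → X | ∀ i, N < i → i ≤ N + m → ω i ∉ A}.indicator
        (fun ω => f (ω (N + m))) ω ∂pathLaw P x
      = ∫⁻ y, ((taboo P A)^[m] f) y ∂(P ^ N) x := by
  induction m generalizing f with
  | zero =>
    rw [Function.iterate_zero, id, ← lintegral_pathLaw_eval P x N hf]
    refine lintegral_congr fun ω => Set.indicator_of_mem ?_ _
    intro i h1 h2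
    omega
  | succ m ih =>
    rw [Function.iterate_succ_apply, ← ih (measurable_taboo hA hf)]
    set S : Set (Finset.Iic (N + m) → X) := {h | ∀ i, N < i.1 → h i ∉ A} with hS
    have hSm : MeasurableSet S := by
      simp only [hS, Set.ofPred_forall]
      exact MeasurableSet.iInter fun i => MeasurableSet.iInter fun _ =>
        hA.compl.preimage (measurable_pi_apply i)
    have hSiff : ∀ ω : ℕ → X, (fun i : Finset.Iic (N + m) => ω i) ∈ S ↔
        ∀ i, N < i → i ≤ N + m → ω i ∉ A := fun ω =>
      ⟨fun h i h1 h2 => h ⟨i, Finset.mem_Iic.2 h2⟩ h1,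
        fun h i h1 => h i.1 h1 (Finset.mem_Iic.1 i.2)⟩
    have h := lintegral_pathLaw_succ P x (N + m) (F := S.indicator 1)
      (measurable_one.indicator hSm) (hf.indicator hA.compl)
    rw [lintegral_congr fun ω => ?_, h, lintegral_congr fun ω => ?_]
    · rw [lintegral_indicator hA.compl]
      by_cases hω : (fun i : Finset.Iic (N + m) => ω i) ∈ S
      · rw [Set.indicator_of_mem hω, Set.indicator_of_mem (by exact (hSiff ω).1 hω), Pi.one_apply,
          one_mul, taboo]
      · rw [Set.indicator_of_notMem hω, Set.indicator_of_notMem (by exact fun h' => hω ((hSiff ω).2 h')),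
          zero_mul]
    · by_cases hω : (fun i : Finset.Iic (N + m) => ω i) ∈ S
      · rw [Set.indicator_of_mem hω, Pi.one_apply]
        by_cases hy : ω (N + m + 1) ∈ A
        · rw [Set.indicator_of_notMem (s := Aᶜ) (by simpa using hy), mul_zero,
            Set.indicator_of_notMem]
          exact fun h' => h' (N + m + 1) (by omega) (by omega) hy
        · rw [Set.indicator_of_mem (s := Aᶜ) (by exact hy), one_mul, Set.indicator_of_mem]
          · rfl
          intro i h1 h2
          rcases Nat.lt_or_ge (N + m) i with h3 | h3
          · obtain rfl : i = N + m + 1 := by omega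
            exact hy
          · exact (hSiff ω).1 hω i h1 h3
      · rw [Set.indicator_of_notMem hω, zero_mul, Set.indicator_of_notMem]
        exact fun h' => hω ((hSiff ω).2 fun i h1 h2 => h' i h1 (by omega))

lemma pathLaw_avoid (hA : MeasurableSet A) (x : X) (N m : ℕ) :
    pathLaw P x {ω : ℕ → X | ∀ i, N < i → i ≤ N + m → ω i ∉ A}
      = ∫⁻ y, ((taboo P A)^[m] 1) y ∂(P ^ N) x := by
  rw [← lintegral_pathLaw_avoid P hA x N m measurable_one]
  exact (lintegral_indicator_one (measurableSet_avoid hA N m)).symm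

omit [MeasurableSpace X] in
-- The tail sum `τ = ∑ₘ 1{τ > m}`.
lemma returnTime_eq_tsum (A : Set X) (ω : ℕ → X) :
    returnTime A ω = ∑' m : ℕ,
      {ω : ℕ → X | ∀ i, 0 < i → i ≤ 0 + m → ω i ∉ A}.indicator (1 : (ℕ → X) → ℝ≥0∞) ω := by
  classical
  by_cases h : ∃ n, 1 ≤ n ∧ ω n ∈ A
  · have hmin : ∀ n, 1 ≤ n ∧ ω n ∈ A → Nat.find h ≤ n := fun n hn => Nat.find_min' h hn
    have h1 : returnTime A ω = (Nat.find h : ℝ≥0∞) := by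
      refine le_antisymm (iInf₂_le (Nat.find h) (Nat.find_spec h)) (le_iInf₂ fun n hn => ?_)
      exact_mod_cast hmin n hn
    rw [h1, tsum_eq_sum (s := Finset.range (Nat.find h))]
    · rw [Finset.sum_congr rfl (g := fun _ => (1 : ℝ≥0∞))]
      · simp
      · intro m hm
        rw [Set.indicator_of_mem, Pi.one_apply]
        intro i h2 h3 h4
        have := hmin i ⟨h2, h4⟩
        have := Finset.mem_range.1 hm
        omega
    · intro m hm
      rw [Set.indicator_of_notMem]
      intro h'
      rw [Finset.mem_range, not_lt] at hm
      exact h' _ (Nat.find_spec h).1 (by omega) (Nat.find_spec h).2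
  · push Not at h
    have h1 : returnTime A ω = ∞ := by
      simp only [returnTime, iInf_eq_top]
      exact fun n hn => absurd hn.2 (h n hn.1)
    rw [h1, tsum_congr (g := fun _ => (1 : ℝ≥0∞)), ENNReal.tsum_const_eq_top_of_ne_zero one_ne_zero]
    intro m
    rw [Set.indicator_of_mem, Pi.one_apply]
    exact fun i h2 _ => h i h2

lemma meanReturnTime_eq_tabooMean (hA : MeasurableSet A) (x : X) :
    meanReturnTime P A x = tabooMean P A x := by
  unfold meanReturnTime tabooMean
  simp_rw [returnTime_eq_tsum]
  rw [lintegral_tsum fun m =>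
    (measurable_one.indicator (measurableSet_avoid hA 0 m)).aemeasurable]
  refine tsum_congr fun m => ?_
  rw [lintegral_indicator_one (measurableSet_avoid hA 0 m), pathLaw_avoid P hA, 
    lintegral_pow_zero P x (measurable_taboo_iterate hA measurable_one m)]

/-- If every starting point returns to `A` almost surely, then `A` is visited infinitely often. -/
lemma ae_visits_eq_top (hA : MeasurableSet A) (h : ∀ x, ⨅ n, ((taboo P A)^[n] 1) x = 0) (x : X) :
    ∀ᵐ ω ∂pathLaw P x, (∑' n : ℕ, A.indicator (fun _ => (1 : ℝ≥0∞)) (ω (n + 1))) = ∞ := by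
  -- By the Markov property at time `N`, the probability of no visit after `N` is the integral of
  -- the non-return probability against `P ^ N`.
  have hN : ∀ N : ℕ, ∀ᵐ ω ∂pathLaw P x, ∃ i, N < i ∧ ω i ∈ A := by
    intro N
    rw [ae_iff]
    have h0 : ∫⁻ y, ⨅ n, ((taboo P A)^[n] 1) y ∂(P ^ N) x = 0 := by simp [h]
    rw [lintegral_iInf (fun n => measurable_taboo_iterate hA measurable_one n)
      antitone_taboo_iterate] at h0
    · refine le_antisymm ?_ bot_le
      rw [← h0]
      refine le_iInf fun m => ?_
      rw [← pathLaw_avoid P hA x N m]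
      refine measure_mono fun ω hω i h1 _ h3 => hω ⟨i, h1, h3⟩
    · rw [← pathLaw_avoid P hA x N 0]
      exact measure_ne_top _ _
  filter_upwards [ae_all_iff.2 hN] with ω hω
  have hinf : {n : ℕ | ω (n + 1) ∈ A}.Infinite := by
    refine Set.infinite_of_forall_exists_gt fun n => ?_
    obtain ⟨i, h1, h2⟩ := hω (n + 1)
    exact ⟨i - 1, by rwa [Set.mem_ofPred_eq, Nat.sub_add_cancel (by omega)], by omega⟩
  have := hinf.to_subtype
  rw [← ENNReal.tsum_const_eq_top_of_ne_zero (α := {n : ℕ | ω (n + 1) ∈ A}) one_ne_zero,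
    tsum_subtype {n : ℕ | ω (n + 1) ∈ A} (fun _ => (1 : ℝ≥0∞))]
  rfl

end PathLaw

end MarkovErgodicity

namespace MarkovErgodicity

/-! ### Ergodicity through an accessible atom. -/

section Atom

variable {X : Type*} [MeasurableSpace X] [MeasurableSingletonClass X]
  {P : Kernel X X} [IsMarkovKernel P]

/-- Telescoping, written without subtraction: applying `P` to the partial potential of `{a}ᶜ` trades
its term at time `0` for one at time `n`, and the complementary masses sum to `1`. -/
lemma lintegral_potential_add (a : X) (n : ℕ) (x : X) :
    ∫⁻ y, ∑ j ∈ Finset.range n, (P ^ j) y {a}ᶜ ∂P x + (P ^ n) x {a}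
      = ∑ j ∈ Finset.range n, (P ^ j) x {a}ᶜ + (P ^ 0) x {a} := by
  induction n with
  | zero => simp
  | succ n ih =>
    have hc : ∀ n, (P ^ n) x {a} + (P ^ n) x {a}ᶜ = 1 := fun n => by
      rw [measure_add_measure_compl (measurableSet_singleton a), measure_univ]
    have hn : ∫⁻ y, (P ^ n) y {a}ᶜ ∂P x = (P ^ (n + 1)) x {a}ᶜ := by
      rw [add_comm n 1, Kernel.pow_add_apply_eq_lintegral _ _ _ _
        (measurableSet_singleton a).compl, pow_one]
    simp_rw [Finset.sum_range_succ]
    rw [lintegral_add_right _ (Kernel.measurable_coe _ (measurableSet_singleton a).compl), hn,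
      add_assoc, add_comm ((P ^ (n + 1)) x {a}ᶜ), hc, ← hc n, ← add_assoc, ih]
    ring

/-- Integrating a positive function against the petite minorization shows that `a` is reached from
all of `C` with a uniform lower bound, within boundedly many steps once the tail of the sampling
distribution is cut. -/
lemma exists_le_sum_pow_of_isPetite (a : X) (hacc : ∀ x, x ≠ a → 0 < P x {a}) {C : Set X}
    (hC : IsPetite P C) :
    ∃ (N : ℕ) (K : ℝ≥0∞), K ≠ ∞ ∧ ∀ x ∈ C, 1 ≤ K * ∑ n ∈ Finset.range N, (P ^ n) x {a} := by
  obtain ⟨_, p, ν, hν, hle⟩ := hC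
  have hma : MeasurableSet ({a} : Set X) := measurableSet_singleton a
  -- The term at time `0` makes `q` positive at `a` as well, where `hacc` gives nothing.
  set q : X → ℝ≥0∞ := fun y => (P ^ 0) y {a} + P y {a} with hq
  have hqm : Measurable q := (Kernel.measurable_coe _ hma).add (Kernel.measurable_coe _ hma)
  have hqpos : ∀ y, q y ≠ 0 := by
    intro y
    by_cases hy : y = a
    · have : (P ^ 0) y {a} = 1 := by
        rw [← lintegral_indicator_one hma, lintegral_pow_zero P y (measurable_one.indicator hma)]
        simp [hy]
      simp only [hq, this]
      simp
    · simp [hq, (hacc y hy).ne']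
  set δ := ∫⁻ y, q y ∂ν with hδ
  have hδ0 : δ ≠ 0 := by
    intro h
    rw [hδ, lintegral_eq_zero_iff hqm] at h
    refine hν (Measure.measure_univ_eq_zero.1 ?_)
    refine measure_mono_null (fun y _ => ?_) (ae_iff.1 h)
    exact hqpos y
  have hq1 : ∀ n x, ∫⁻ y, q y ∂(P ^ n) x = (P ^ n) x {a} + (P ^ (n + 1)) x {a} := by
    intro n x
    rw [Kernel.pow_succ_apply_eq_lintegral _ _ _ hma]
    simp only [hq]
    rw [lintegral_add_right _ (Kernel.measurable_coe _ hma)]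
    congr 1
    rw [← Kernel.pow_add_apply_eq_lintegral _ _ _ _ hma, add_zero]
  have hsum : ∀ x ∈ C, δ ≤ ∑' n : ℕ, p n * ((P ^ n) x {a} + (P ^ (n + 1)) x {a}) := by
    intro x hx
    have h1 : ν ≤ Measure.sum fun n => p n • (P ^ n) x := by
      refine Measure.le_iff.2 fun B hB => ?_
      rw [Measure.sum_apply _ hB]
      exact hle x hx B hB
    refine (lintegral_mono' h1 le_rfl).trans ?_
    rw [lintegral_sum_measure]
    simp_rw [lintegral_smul_measure, hq1]
    rfl
  by_cases hne : C.Nonempty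
  swap
  · exact ⟨0, 0, by simp, fun x hx => absurd ⟨x, hx⟩ hne⟩
  have hbd : ∀ n x, (P ^ n) x {a} + (P ^ (n + 1)) x {a} ≤ 2 := fun n x => by
    rw [← one_add_one_eq_two]
    exact add_le_add prob_le_one prob_le_one
  have hδtop : δ ≠ ∞ := by
    obtain ⟨x, hx⟩ := hne
    refine ne_top_of_le_ne_top (b := 2) (by simp) ((hsum x hx).trans ?_)
    calc _ ≤ ∑' n, p n * 2 := ENNReal.tsum_le_tsum fun n => by gcongr; exact hbd n x
      _ = 2 := by rw [ENNReal.tsum_mul_right, p.tsum_coe, one_mul]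
  have htail := ENNReal.tendsto_sum_nat_add (fun n => p n) p.tsum_coe_ne_top
  -- Each bracket in the series is at most `2`, so a tail of mass below `δ / 4` costs at most `δ /
  -- 2`.
  have hδ4 : 0 < δ / 4 := ENNReal.div_pos hδ0 (by simp)
  obtain ⟨N, hN⟩ := (htail.eventually (gt_mem_nhds hδ4)).exists
  refine ⟨N + 1, 2 * (δ / 2)⁻¹, ?_, fun x hx => ?_⟩
  · exact ENNReal.mul_ne_top (by simp) (ENNReal.inv_ne_top.2 (ENNReal.div_pos hδ0 (by simp)).ne')
  have h1 := hsum x hx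
  rw [← Summable.sum_add_tsum_nat_add' (k := N) ENNReal.summable] at h1
  have h2 : ∑' n, p (n + N) * ((P ^ (n + N)) x {a} + (P ^ (n + N + 1)) x {a}) ≤ δ / 2 := by
    calc _ ≤ ∑' n, p (n + N) * 2 := ENNReal.tsum_le_tsum fun n => by gcongr; exact hbd _ x
      _ = (∑' n, p (n + N)) * 2 := ENNReal.tsum_mul_right
      _ ≤ δ / 4 * 2 := by gcongr
      _ = δ / 2 := by
        rw [ENNReal.div_eq_inv_mul, ENNReal.div_eq_inv_mul, mul_right_comm,
          show (4 : ℝ≥0∞) = 2 * 2 by norm_num, ENNReal.mul_inv (by simp) (by simp), mul_assoc 2⁻¹,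
          ENNReal.inv_mul_cancel (by simp) (by simp), mul_one]
  have h3 : ∑ n ∈ Finset.range N, p n * ((P ^ n) x {a} + (P ^ (n + 1)) x {a})
      ≤ 2 * ∑ n ∈ Finset.range (N + 1), (P ^ n) x {a} := by
    rw [two_mul]
    calc _ ≤ ∑ n ∈ Finset.range N, ((P ^ n) x {a} + (P ^ (n + 1)) x {a}) :=
          Finset.sum_le_sum fun n _ => mul_le_of_le_one_left' (p.coe_le_one n)
      _ = _ := Finset.sum_add_distrib
      _ ≤ _ := by
        gcongr
        · omega
        · rw [Finset.sum_range_succ']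
          exact le_self_add
  have h4 : δ / 2 ≤ 2 * ∑ n ∈ Finset.range (N + 1), (P ^ n) x {a} := by
    have h5 : δ / 2 + δ / 2 ≤ 2 * ∑ n ∈ Finset.range (N + 1), (P ^ n) x {a} + δ / 2 := by
      rw [ENNReal.add_halves]
      exact h1.trans (add_le_add h3 h2)
    exact (ENNReal.add_le_add_iff_right (ENNReal.div_ne_top hδtop (by simp))).1 h5
  rw [mul_right_comm, ← ENNReal.div_eq_inv_mul.trans (mul_comm _ _)]
  rw [ENNReal.le_div_iff_mul_le (Or.inl (ENNReal.div_pos hδ0 (by simp)).ne')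
    (Or.inl (ENNReal.div_ne_top hδtop (by simp))), one_mul]
  exact h4

/-- A drift function towards `C` is turned into one towards `a`. The excess on `C` is at most `B * K
* S` by petiteness, and adding `B * K * H` absorbs it, because `P H + S` exceeds `H` only at `a`. -/
lemma tabooMean_atom_ne_top (a : X) (hacc : ∀ x, x ≠ a → 0 < P x {a}) {C : Set X}
    (hC : IsPetite P C) (hne : C.Nonempty) (hfin : (⨆ x ∈ C, meanReturnTime P C x) < ∞) :
    tabooMean P {a} a ≠ ∞ := by
  have hCm : MeasurableSet C := hC.1
  have hma : MeasurableSet ({a} : Set X) := measurableSet_singleton a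
  obtain ⟨N, K, hK, hpet⟩ := exists_le_sum_pow_of_isPetite a hacc hC
  set B := ⨆ x ∈ C, meanReturnTime P C x with hB
  set h := tabooMean P C with hh
  have hhm : Measurable h := measurable_tabooMean hCm
  have hhB : ∀ x ∈ C, h x ≤ B := fun x hx => by
    rw [hh, ← meanReturnTime_eq_tabooMean P hCm]
    exact le_iSup₂_of_le x hx le_rfl
  set V : X → ℝ≥0∞ := Cᶜ.indicator h with hV
  have hVm : Measurable V := hhm.indicator hCm.compl
  have hPV : ∀ x, ∫⁻ y, V y ∂P x + 1 = h x := fun x => by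
    rw [hh, tabooMean_eq hCm, hV, lintegral_indicator hCm.compl, add_comm]
    rfl
  set S : X → ℝ≥0∞ := fun x => ∑ n ∈ Finset.range N, (P ^ n) x {a} with hS
  have hhV : ∀ x, h x ≤ V x + B * (K * S x) := fun x => by
    by_cases hx : x ∈ C
    · calc h x ≤ B * 1 := by rw [mul_one]; exact hhB x hx
        _ ≤ B * (K * S x) := by gcongr; exact hpet x hx
        _ ≤ _ := le_add_self
    · rw [hV, Set.indicator_of_mem (by exact hx)]
      exact le_self_add
  set G : ℕ → X → ℝ≥0∞ := fun n x => ∑ j ∈ Finset.range n, (P ^ j) x {a}ᶜ with hG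
  have hGm : ∀ n, Measurable (G n) := fun n =>
    Finset.measurable_sum _ fun j _ => Kernel.measurable_coe _ hma.compl
  set H : X → ℝ≥0∞ := fun x => ∑ n ∈ Finset.range N, G n x with hH
  have hHm : Measurable H := Finset.measurable_sum _ fun j _ => hGm j
  have hPH : ∀ x, ∫⁻ y, H y ∂P x + S x = H x + N * (P ^ 0) x {a} := fun x => by
    rw [hH, lintegral_finsetSum _ fun n _ => hGm n, hS, ← Finset.sum_add_distrib,
      Finset.sum_congr rfl fun n _ => lintegral_potential_add a n x, Finset.sum_add_distrib]
    simp only [Finset.sum_const, Finset.card_range, nsmul_eq_mul, hG]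
  set W : X → ℝ≥0∞ := fun x => V x + B * (K * H x) with hW
  set U : X → ℝ≥0∞ := fun x => W x + B * (K * (N * (P ^ 0) x {a})) with hU
  have hWU : ∀ x, 1 + ∫⁻ y, W y ∂P x ≤ U x := fun x => by
    calc 1 + ∫⁻ y, W y ∂P x = h x + B * (K * ∫⁻ y, H y ∂P x) := by
          rw [hW, lintegral_add_left hVm, lintegral_const_mul _ (hHm.const_mul _),
            lintegral_const_mul _ hHm, ← hPV x]
          ring
      _ ≤ V x + B * (K * S x) + B * (K * ∫⁻ y, H y ∂P x) := by gcongr; exact hhV x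
      _ = V x + B * (K * (∫⁻ y, H y ∂P x + S x)) := by ring
      _ = U x := by rw [hPH, hU, hW]; ring
  have hp0 : ∀ x, x ≠ a → (P ^ 0) x {a} = 0 := fun x hx => by
    rw [← lintegral_indicator_one hma, lintegral_pow_zero P x (measurable_one.indicator hma)]
    simp [hx]
  have hUd : ∀ x, 1 + taboo P {a} U x ≤ U x := fun x => by
    refine le_trans (add_le_add le_rfl ?_) (hWU x)
    refine le_trans (le_of_eq ?_) (taboo_le_lintegral (A := {a}) W x)
    refine setLIntegral_congr_fun hma.compl fun y hy => ?_
    simp only [hU, hp0 y hy, mul_zero, add_zero]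
  refine ne_top_of_le_ne_top ?_ (tabooMean_le_of_drift hma hUd a)
  -- If `a ∉ C`, a point of `C` jumps to `a` with positive probability, so an infinite `V a` would
  -- contradict the bound `B` on its mean return time.
  have hVa : V a ≠ ∞ := by
    by_cases ha : a ∈ C
    · rw [hV, Set.indicator_of_notMem (by simpa using ha)]
      simp
    · rw [hV, Set.indicator_of_mem (by exact ha)]
      obtain ⟨x, hx⟩ := hne
      have hxa : x ≠ a := fun e => ha (e ▸ hx)
      intro htop
      have h1 : ∫⁻ y, V y ∂P x ≤ B := le_trans (le_self_add.trans (hPV x).le) (hhB x hx)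
      have h2 : ∫⁻ y in {a}, V y ∂P x ≤ ∫⁻ y, V y ∂P x := setLIntegral_le_lintegral _ _
      rw [lintegral_singleton, hV, Set.indicator_of_mem (by exact ha), htop,
        ENNReal.top_mul (hacc x hxa).ne'] at h2
      exact absurd (h2.trans h1) (not_le.2 hfin)
  have hHa : H a ≠ ∞ := ENNReal.sum_ne_top.2 fun n _ => ENNReal.sum_ne_top.2 fun j _ =>
    measure_ne_top _ _
  exact ENNReal.add_ne_top.2 ⟨ENNReal.add_ne_top.2 ⟨hVa, ENNReal.mul_ne_top hfin.ne
    (ENNReal.mul_ne_top hK hHa)⟩, ENNReal.mul_ne_top hfin.ne (ENNReal.mul_ne_top hK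
    (ENNReal.mul_ne_top (by simp) (measure_ne_top _ _)))⟩

/-- The probability of never returning to `A` vanishes if `A` is accessible from an atom whose
expected hitting time is finite. -/
lemma iInf_taboo_iterate_eq_zero {a : X} (hfin : ∀ x, tabooMean P {a} x ≠ ∞) {A : Set X}
    (hA : MeasurableSet A) {k : ℕ} (hk : 0 < (P ^ (k + 1)) a A) (x : X) :
    ⨅ n, ((taboo P A)^[n] 1) x = 0 := by
  have hma : MeasurableSet ({a} : Set X) := measurableSet_singleton a
  set u : X → ℝ≥0∞ := fun x => ⨅ n, ((taboo P A)^[n] 1) x with hu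
  have hum : Measurable u := Measurable.iInf fun n => measurable_taboo_iterate hA measurable_one n
  have hu1 : u ≤ 1 := fun x => (iInf_le _ 0).trans le_rfl
  have hut : u ≤ taboo P A u := fun x => by
    have : taboo P A u x = ⨅ n, ((taboo P A)^[n + 1] 1) x := by
      simp_rw [Function.iterate_succ_apply']
      refine lintegral_iInf (fun n => measurable_taboo_iterate hA measurable_one n)
        antitone_taboo_iterate ?_
      simp
    rw [this]
    exact le_iInf fun n => iInf_le _ (n + 1)
  -- Here `u` is the probability of never returning to `A`: within `n` steps either `a` is hit,
  -- leaving at most `u a`, or `a` has been avoided throughout. As `n → ∞` this makes `u a` the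
  -- maximum of `u`.
  have hua : ∀ n x, u x ≤ u a + ((taboo P {a})^[n] 1) x := by
    intro n
    induction n with
    | zero => exact fun x => (hu1 x).trans le_add_self
    | succ n ih =>
      intro x
      have h1 : u x ≤ ∫⁻ y, u y ∂P x := (hut x).trans (taboo_le_lintegral u x)
      rw [← lintegral_add_compl u hma, lintegral_singleton] at h1
      refine h1.trans ?_
      rw [Function.iterate_succ_apply']
      calc u a * P x {a} + ∫⁻ y in {a}ᶜ, u y ∂P x
          ≤ u a * P x {a} + ∫⁻ y in {a}ᶜ, (u a + ((taboo P {a})^[n] 1) y) ∂P x := by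
            gcongr with y
            exact ih y
        _ = u a * (P x {a} + P x {a}ᶜ) + taboo P {a} ((taboo P {a})^[n] 1) x := by
            rw [lintegral_add_left measurable_const, lintegral_const,
              Measure.restrict_apply MeasurableSet.univ, Set.univ_inter, taboo]
            ring
        _ = _ := by rw [measure_add_measure_compl hma, measure_univ, mul_one]
  have hle : ∀ x, u x ≤ u a := fun x => by
    have h0 := ENNReal.tendsto_atTop_zero_of_tsum_ne_top (hfin x)
    have := (tendsto_const_nhds (x := u a)).add h0
    rw [add_zero] at this
    exact ge_of_tendsto' this fun n => hua n x
  -- Never returning requires surviving `n` steps and then never returning, the latter with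
  -- probability at most `u a`. At `x = a`, `n = k + 1` the survival factor is below `1`, forcing `u
  -- a = 0`.
  have hmul : ∀ n x, u x ≤ u a * ((taboo P A)^[n] 1) x := by
    intro n
    induction n with
    | zero => exact fun x => (hle x).trans (by simp)
    | succ n ih =>
      intro x
      refine (hut x).trans ((taboo_mono (fun y => ih y) x).trans ?_)
      rw [Function.iterate_succ_apply', taboo,
        lintegral_const_mul _ (measurable_taboo_iterate hA measurable_one n)]
      exact le_rfl
  have hlt : ((taboo P A)^[k + 1] 1) a < 1 := by
    have h1 := taboo_iterate_add_pow_le hA k a (P := P)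
    by_contra! h2
    have h3 : 1 + (P ^ (k + 1)) a A ≤ 1 + 0 := by
      rw [add_zero]
      exact (add_le_add h2 le_rfl).trans h1
    exact absurd ((ENNReal.add_le_add_iff_left (by simp)).1 h3) (not_le.2 hk)
  have h0 : u a = 0 := by
    by_contra h
    have h1 := hmul (k + 1) a
    have h2 : u a * ((taboo P A)^[k + 1] 1) a < u a * 1 :=
      ENNReal.mul_lt_mul_right h (ne_top_of_le_ne_top (by simp) (hu1 a)) hlt
    rw [mul_one] at h2
    exact absurd h1 (not_le.2 h2)
  exact le_antisymm ((hle x).trans h0.le) bot_le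

/-- A chain with an accessible atom that has finite expected hitting times is ergodic. -/
lemma isErgodic_of_atom (a : X) (hacc : ∀ x, ∃ n, 0 < (P ^ (n + 1)) x {a})
    (hfin : ∀ x, tabooMean P {a} x ≠ ∞) : IsErgodic P := by
  have hma : MeasurableSet ({a} : Set X) := measurableSet_singleton a
  set w : ℕ → ℝ≥0∞ := fun n => 2⁻¹ ^ (n + 1) with hw
  have hw0 : ∀ n, w n ≠ 0 := fun n => by simp [hw]
  -- The null sets of `ψ` are those never charged from `a`, which is what maximality needs;
  -- accessibility of `a` gives irreducibility.
  set ψ : Measure X := Measure.sum fun n => w n • (P ^ n) a with hψ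
  have hψA : ∀ A, MeasurableSet A → ψ A = ∑' n, w n * (P ^ n) a A := fun A hA => by
    rw [hψ, Measure.sum_apply _ hA]
    rfl
  have hψpos : ∀ A, MeasurableSet A → 0 < ψ A → ∃ n, 0 < (P ^ n) a A := by
    intro A hA h
    by_contra! h0
    rw [hψA A hA] at h
    exact h.ne' (ENNReal.tsum_eq_zero.2 fun n => by simp [le_antisymm (h0 n) bot_le])
  have hpos : ∀ A, MeasurableSet A → 0 < ψ A → ∀ x, ∃ n, 0 < (P ^ (n + 1)) x A := by
    intro A hA h x
    obtain ⟨n, hn⟩ := hψpos A hA h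
    obtain ⟨m, hm⟩ := hacc x
    refine ⟨m + n, ?_⟩
    rw [show m + n + 1 = m + 1 + n by omega, Kernel.pow_add_apply_eq_lintegral _ _ _ _ hA]
    refine lt_of_lt_of_le ?_ (setLIntegral_le_lintegral {a} _)
    rw [lintegral_singleton]
    exact ENNReal.mul_pos hn.ne' hm.ne'
  have hfinψ : IsFiniteMeasure ψ := ⟨by
    rw [hψA _ MeasurableSet.univ]
    simp only [measure_univ, mul_one, hw, pow_succ, ENNReal.tsum_mul_right, ENNReal.tsum_geometric]
    exact ENNReal.mul_lt_top (by simp) (by simp)⟩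
  have hψa : 0 < ψ {a} := by
    rw [hψA _ hma]
    refine lt_of_lt_of_le ?_ (ENNReal.le_tsum 0)
    have : (P ^ 0) a {a} = 1 := by
      rw [← lintegral_indicator_one hma, lintegral_pow_zero P a (measurable_one.indicator hma)]
      simp
    rw [this, mul_one]
    exact (hw0 0).bot_lt
  refine ⟨ψ, ⟨⟨inferInstance, fun A hA h x => ?_⟩, fun φ hφ => ?_⟩, fun A hA h => ?_,
    {a}, ⟨hma, PMF.pure 0, Measure.dirac a, (Measure.dirac_ne_zero), fun x hx B hB => ?_⟩, hψa, ?_⟩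
  · obtain ⟨n, hn⟩ := hpos A hA h x
    exact lt_of_lt_of_le hn (ENNReal.le_tsum (f := fun n => (P ^ (n + 1)) x A) n)
  · refine Measure.AbsolutelyContinuous.mk fun A hA h => ?_
    by_contra h0
    refine (hφ.2 A hA (pos_iff_ne_zero.2 h0) a).ne' (ENNReal.tsum_eq_zero.2 fun n => ?_)
    rw [hψA A hA, ENNReal.tsum_eq_zero] at h
    exact (mul_eq_zero.1 (h (n + 1))).resolve_left (hw0 _)
  · obtain ⟨n, hn⟩ := hpos A hA h a
    exact ae_visits_eq_top P hA (iInf_taboo_iterate_eq_zero hfin hA hn)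
  · rw [Set.mem_singleton_iff] at hx
    subst hx
    refine le_trans ?_ (ENNReal.le_tsum 0)
    rw [PMF.pure_apply, if_pos rfl, one_mul, ← lintegral_indicator_one hB,
      ← lintegral_indicator_one hB, lintegral_pow_zero P x (measurable_one.indicator hB),
      lintegral_dirac' _ (measurable_one.indicator hB)]
  · simp only [Set.mem_singleton_iff, iSup_iSup_eq_left]
    rw [meanReturnTime_eq_tabooMean P hma]
    exact (hfin a).lt_top

end Atom

end MarkovErgodicity

namespace MarkovErgodicity

/-! ### The immigration chain: bounds for the return to `0`. -/

namespace ImmigrationChain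

variable (M : ImmigrationChain)

lemma lintegral_kernel_zero {f : ℝ≥0 → ℝ≥0∞} (hf : Measurable f) :
    ∫⁻ y, f y ∂M.kernel 0 = ∫⁻ y, ENNReal.ofReal (M.β y) * f y ∂lebesgue := by
  have : M.kernel 0 = lebesgue.withDensity (fun y => ENNReal.ofReal (M.β y)) := if_pos rfl
  rw [this, lintegral_withDensity_eq_lintegral_mul _ M.measurable_β.ennreal_ofReal hf]
  rfl

lemma lintegral_kernel_of_ne_zero {x : ℝ≥0} (hx : x ≠ 0) (f : ℝ≥0 → ℝ≥0∞) :
    ∫⁻ y, f y ∂M.kernel x = ENNReal.ofReal (M.γ x) * f 0 + ENNReal.ofReal (M.b x) * f (x + 1)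
      + ENNReal.ofReal (1 - M.γ x - M.b x) * f x := by
  have : M.kernel x = ENNReal.ofReal (M.γ x) • Measure.dirac 0
      + ENNReal.ofReal (M.b x) • Measure.dirac (x + 1)
      + ENNReal.ofReal (1 - M.γ x - M.b x) • Measure.dirac x := if_neg hx
  rw [this]
  simp only [lintegral_add_measure, lintegral_smul_measure, lintegral_dirac, smul_eq_mul]

lemma taboo_zero_of_ne_zero {x : ℝ≥0} (hx : x ≠ 0) (f : ℝ≥0 → ℝ≥0∞) :
    taboo M.kernel {0} f x = ENNReal.ofReal (M.b x) * f (x + 1)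
      + ENNReal.ofReal (1 - M.γ x - M.b x) * f x := by
  rw [taboo, ← lintegral_indicator (measurableSet_singleton 0).compl,
    lintegral_kernel_of_ne_zero M hx]
  simp [hx]

lemma kernel_singleton_zero_pos {x : ℝ≥0} (hx : x ≠ 0) : 0 < M.kernel x {0} := by
  rw [← lintegral_indicator_one (measurableSet_singleton 0), lintegral_kernel_of_ne_zero M hx]
  simp [hx, M.γ_pos x]

/-- If `x` does not jump to `0` at once, its first step lands almost surely off `0`, where a jump to
`0` has positive probability. -/
lemma exists_pow_singleton_zero_pos (x : ℝ≥0) : ∃ n, 0 < (M.kernel ^ (n + 1)) x {0} := by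
  by_cases h : 0 < M.kernel x {0}
  · exact ⟨0, by simpa using h⟩
  have h0 : M.kernel x {0} = 0 := le_antisymm (not_lt.1 h) bot_le
  refine ⟨1, ?_⟩
  rw [Kernel.pow_succ_apply_eq_lintegral _ _ _ (measurableSet_singleton 0), pow_one,
    pos_iff_ne_zero, Ne, lintegral_eq_zero_iff (Kernel.measurable_coe _ (measurableSet_singleton 0))]
  intro h1
  have h2 : M.kernel x {0}ᶜ = 0 :=
    measure_mono_null (fun y hy => (M.kernel_singleton_zero_pos hy).ne') (ae_iff.1 h1)
  have h3 := measure_add_measure_compl (μ := M.kernel x) (measurableSet_singleton 0)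
  rw [h0, h2, measure_univ, add_zero] at h3
  exact zero_ne_one h3

/-- Before hitting `0` the chain never goes below `y`, so each step survives with probability at
least `1 - s`; sum the geometric series. -/
lemma inv_le_tabooMean {y : ℝ≥0} (hy : y ≠ 0) {s : ℝ} (hs : ∀ u, y ≤ u → M.γ u ≤ s) (hs1 : s ≤ 1) :
    (ENNReal.ofReal s)⁻¹ ≤ tabooMean M.kernel {0} y := by
  have key : ∀ n : ℕ, ∀ u, y ≤ u → (1 - ENNReal.ofReal s) ^ n ≤ ((taboo M.kernel {0})^[n] 1) u := by
    intro n
    induction n with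
    | zero => intro u _; simp
    | succ n ih =>
      intro u hu
      have hu0 : u ≠ 0 := fun h => hy (le_antisymm (h ▸ hu) bot_le)
      rw [Function.iterate_succ_apply', M.taboo_zero_of_ne_zero hu0, pow_succ']
      have h1 := M.b_pos u
      have h2 := M.b_add_γ_le_one u
      calc (1 - ENNReal.ofReal s) * (1 - ENNReal.ofReal s) ^ n
          ≤ ENNReal.ofReal (1 - M.γ u) * (1 - ENNReal.ofReal s) ^ n := by
            gcongr
            rw [← ENNReal.ofReal_one, ← ENNReal.ofReal_sub _ ((M.γ_pos u).le.trans (hs u hu))]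
            exact ENNReal.ofReal_le_ofReal (by linarith [hs u hu])
        _ = ENNReal.ofReal (M.b u) * (1 - ENNReal.ofReal s) ^ n
            + ENNReal.ofReal (1 - M.γ u - M.b u) * (1 - ENNReal.ofReal s) ^ n := by
            rw [← add_mul, ← ENNReal.ofReal_add h1.le (by linarith)]
            congr 2
            ring
        _ ≤ _ := by
            gcongr
            · exact ih (u + 1) (hu.trans le_self_add)
            · exact ih u hu
  calc (ENNReal.ofReal s)⁻¹ = ∑' n : ℕ, (1 - ENNReal.ofReal s) ^ n := by
        rw [ENNReal.tsum_geometric, ENNReal.sub_sub_cancel (by simp)]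
        rw [← ENNReal.ofReal_one]
        exact ENNReal.ofReal_le_ofReal hs1
    _ ≤ _ := ENNReal.tsum_le_tsum fun n => key n y le_rfl

lemma tabooMean_zero_eq_top {x₁ : ℝ≥0}
    (h : (∫⁻ y in Set.Ioi x₁, ENNReal.ofReal (M.β y / sSup (M.γ '' Set.Ici y)) ∂lebesgue) = ∞) :
    tabooMean M.kernel {0} 0 = ∞ := by
  have hm : Measurable (tabooMean M.kernel {(0 : ℝ≥0)}) :=
    measurable_tabooMean (measurableSet_singleton 0)
  have hγ1 : ∀ u, M.γ u ≤ 1 := fun u => by linarith [M.b_pos u, M.b_add_γ_le_one u]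
  have hle : ∀ y ∈ Set.Ioi x₁, ENNReal.ofReal (M.β y / sSup (M.γ '' Set.Ici y))
      ≤ ENNReal.ofReal (M.β y) * ({0}ᶜ : Set ℝ≥0).indicator (tabooMean M.kernel {0}) y := by
    intro y hy
    have hy0 : y ≠ 0 := (lt_of_le_of_lt bot_le hy).ne'
    have hbdd : BddAbove (M.γ '' Set.Ici y) := ⟨1, by rintro _ ⟨u, _, rfl⟩; exact hγ1 u⟩
    have hs : ∀ u, y ≤ u → M.γ u ≤ sSup (M.γ '' Set.Ici y) := fun u hu =>
      le_csSup hbdd ⟨u, hu, rfl⟩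
    have hs1 : sSup (M.γ '' Set.Ici y) ≤ 1 :=
      csSup_le ⟨_, y, Set.self_mem_Ici, rfl⟩ (by rintro _ ⟨u, _, rfl⟩; exact hγ1 u)
    rw [ENNReal.ofReal_div_of_pos ((M.γ_pos y).trans_le (hs y le_rfl)), div_eq_mul_inv,
      Set.indicator_of_mem (by simpa using hy0)]
    gcongr
    exact M.inv_le_tabooMean hy0 hs hs1
  rw [tabooMean_eq (measurableSet_singleton 0), taboo,
    ← lintegral_indicator (measurableSet_singleton 0).compl,
    M.lintegral_kernel_zero (hm.indicator (measurableSet_singleton 0).compl), ENNReal.add_eq_top]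
  right
  rw [← top_le_iff, ← h]
  exact (setLIntegral_mono' measurableSet_Ioi hle).trans (setLIntegral_le_lintegral _ _)

theorem not_isErgodic {x₁ : ℝ≥0}
    (h : (∫⁻ y in Set.Ioi x₁, ENNReal.ofReal (M.β y / sSup (M.γ '' Set.Ici y)) ∂lebesgue) = ∞) :
    ¬ IsErgodic M.kernel := by
  rintro ⟨ψ, _, _, C, hC, hψ, hfin⟩
  have hne : C.Nonempty := by
    rw [Set.nonempty_iff_ne_empty]
    rintro rfl
    simp at hψ
  exact tabooMean_atom_ne_top 0 (fun x hx => M.kernel_singleton_zero_pos hx) hC hne hfin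
    (M.tabooMean_zero_eq_top h)

lemma tabooMean_ne_top {x₁ : ℝ≥0} {c : ℝ} (hc : 0 < c)
    (hint : (∫⁻ y in Set.Ioi x₁, ENNReal.ofReal ((c * M.b y + 1) / M.γ y * M.β y) ∂lebesgue) < ∞)
    (hdrift : ∀ x : ℝ≥0, x₁ < x →
      M.b x * (c * (M.b (x + 1) / M.γ (x + 1) - M.b x / M.γ x)
        - 1 / M.γ x + 1 / M.γ (x + 1) - c) ≤ 0) (x : ℝ≥0) :
    tabooMean M.kernel {0} x ≠ ∞ := by
  -- As `γ v = c b + 1`, the drift inequality for `v + K` at `x` reduces to `b(x) (v(x+1) - v(x) -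
  -- c) ≤ γ(x) K`.
  set v : ℝ≥0 → ℝ := fun x => (c * M.b x + 1) / M.γ x with hv
  have hvc : Continuous v :=
    ((continuous_const.mul M.continuous_b).add continuous_const).div M.continuous_γ
      fun x => (M.γ_pos x).ne'
  have hv0 : ∀ x, 0 ≤ v x := fun x => div_nonneg
    (by have := mul_pos hc (M.b_pos x); linarith) (M.γ_pos x).le
  -- The interval reaches `x₁ + 1` because the drift at `x ≤ x₁` involves `v (x + 1)`.
  obtain ⟨B, hB⟩ := (isCompact_Icc (a := (0 : ℝ≥0)) (b := x₁ + 1)).bddAbove_image hvc.continuousOn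
  have hB' : ∀ x, x ≤ x₁ + 1 → v x ≤ B := fun x hx => hB ⟨x, ⟨bot_le, hx⟩, rfl⟩
  have hB0 : 0 ≤ B := (hv0 0).trans (hB' 0 bot_le)
  obtain ⟨z, _, hz⟩ := (isCompact_Icc (a := (0 : ℝ≥0)) (b := x₁)).exists_isMinOn
    ⟨0, by simp⟩ M.continuous_γ.continuousOn
  set K := B / M.γ z with hK
  have hK0 : 0 ≤ K := div_nonneg hB0 (M.γ_pos z).le
  have hγK : ∀ x, x ≤ x₁ → B ≤ M.γ x * K := fun x hx => by
    have h1 : M.γ z ≤ M.γ x := hz ⟨bot_le, hx⟩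
    rw [hK, ← mul_div_assoc, le_div_iff₀ (M.γ_pos z), mul_comm]
    exact mul_le_mul_of_nonneg_right h1 hB0
  have hdrift' : ∀ x, 1 + M.b x * (v (x + 1) + K) + (1 - M.γ x - M.b x) * (v x + K) ≤ v x + K := by
    intro x
    have h1 : M.γ x * v x = c * M.b x + 1 := mul_div_cancel₀ _ (M.γ_pos x).ne'
    have h2 : M.b x * (v (x + 1) - v x - c) ≤ M.γ x * K := by
      rcases lt_or_ge x₁ x with hx | hx
      · refine le_trans (le_of_eq ?_) ((hdrift x hx).trans (mul_nonneg (M.γ_pos x).le hK0))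
        simp only [hv]
        ring
      · refine le_trans ?_ (hγK x hx)
        have h3 : M.b x ≤ 1 := by linarith [M.γ_pos x, M.b_add_γ_le_one x]
        have h4 : v (x + 1) ≤ B := hB' _ (by gcongr)
        calc M.b x * (v (x + 1) - v x - c) ≤ M.b x * B :=
              mul_le_mul_of_nonneg_left (by linarith [hv0 x]) (M.b_pos x).le
          _ ≤ 1 * B := mul_le_mul_of_nonneg_right h3 hB0
          _ = B := one_mul B
    linear_combination h2 - h1
  set V : ℝ≥0 → ℝ≥0∞ := fun x => ENNReal.ofReal (v x + K) with hV
  have hVm : Measurable V := (hvc.add continuous_const).measurable.ennreal_ofReal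
  have hPV : ∫⁻ y, V y ∂M.kernel 0 ≠ ∞ := by
    rw [M.lintegral_kernel_zero hVm]
    have hβm := M.measurable_β.ennreal_ofReal
    have hle : ∀ y, ENNReal.ofReal (M.β y) * V y ≤
        ENNReal.ofReal (M.β y) * ENNReal.ofReal (B + K)
          + (Set.Ioi x₁).indicator (fun y => ENNReal.ofReal ((c * M.b y + 1) / M.γ y * M.β y)) y := by
      intro y
      by_cases hy : y ∈ Set.Ioi x₁
      · rw [Set.indicator_of_mem hy, mul_comm ((c * M.b y + 1) / M.γ y),
          ENNReal.ofReal_mul (M.β_nonneg y), ← mul_add,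
          ← ENNReal.ofReal_add (by positivity) (hv0 y)]
        gcongr
        exact ENNReal.ofReal_le_ofReal (by linarith)
      · rw [Set.indicator_of_notMem hy, add_zero]
        gcongr
        exact ENNReal.ofReal_le_ofReal
          (by linarith [hB' y ((not_lt.1 hy).trans le_self_add)])
    refine ne_top_of_le_ne_top ?_ (lintegral_mono hle)
    rw [lintegral_add_left (hβm.mul_const _), lintegral_mul_const _ hβm, M.lintegral_β, one_mul,
      lintegral_indicator measurableSet_Ioi]
    exact ENNReal.add_ne_top.2 ⟨by simp, hint.ne⟩
  -- The value at `0` is chosen to give equality in the drift inequality there; the killed kernel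
  -- never sees it.
  set U : ℝ≥0 → ℝ≥0∞ := fun x => if x = 0 then 1 + ∫⁻ y, V y ∂M.kernel 0 else V x with hU
  have hUd : ∀ x, 1 + taboo M.kernel {0} U x ≤ U x := by
    intro x
    by_cases hx : x = 0
    · subst hx
      simp only [hU, if_true]
      gcongr
      refine le_trans (le_of_eq ?_) (taboo_le_lintegral (A := {0}) V 0)
      exact setLIntegral_congr_fun (measurableSet_singleton 0).compl fun y hy => if_neg hy
    · rw [M.taboo_zero_of_ne_zero hx]
      simp only [hU, if_neg hx, if_neg (add_pos_of_nonneg_of_pos bot_le one_pos :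
        (0 : ℝ≥0) < x + 1).ne', hV]
      have h1 := (M.b_pos x).le
      have h2 : 0 ≤ 1 - M.γ x - M.b x := by linarith [M.b_add_γ_le_one x]
      have h3 := hv0 x
      have h4 := hv0 (x + 1)
      rw [← ENNReal.ofReal_mul h1, ← ENNReal.ofReal_mul h2, ← ENNReal.ofReal_one, ← add_assoc,
        ← ENNReal.ofReal_add (by positivity) (by positivity),
        ← ENNReal.ofReal_add (by positivity) (by positivity)]
      exact ENNReal.ofReal_le_ofReal (hdrift' x)
  refine ne_top_of_le_ne_top ?_ (tabooMean_le_of_drift (measurableSet_singleton 0) hUd x)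
  simp only [hU]
  split_ifs
  · exact ENNReal.add_ne_top.2 ⟨by simp, hPV⟩
  · exact ENNReal.ofReal_ne_top

end ImmigrationChain

end MarkovErgodicity

theorem proposition5 (M : MarkovErgodicity.ImmigrationChain) :
    ((∃ x₁ : ℝ≥0, 0 < x₁ ∧
        (∫⁻ y in Set.Ioi x₁, ENNReal.ofReal (M.β y / sSup (M.γ '' Set.Ici y))
          ∂MarkovErgodicity.lebesgue) = ∞) →
      ¬ MarkovErgodicity.IsErgodic M.kernel) ∧
    ((∃ (x₁ : ℝ≥0) (c : ℝ), 0 < x₁ ∧ 0 < c ∧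
        (∫⁻ y in Set.Ioi x₁, ENNReal.ofReal ((c * M.b y + 1) / M.γ y * M.β y)
          ∂MarkovErgodicity.lebesgue) < ∞ ∧
        ∀ x : ℝ≥0, x₁ < x →
          M.b x * (c * (M.b (x + 1) / M.γ (x + 1) - M.b x / M.γ x)
            - 1 / M.γ x + 1 / M.γ (x + 1) - c) ≤ 0) →
      MarkovErgodicity.IsErgodic M.kernel) := by
  refine ⟨fun ⟨x₁, _, h⟩ => M.not_isErgodic h, fun ⟨x₁, c, _, hc, hint, hdrift⟩ => ?_⟩
  exact MarkovErgodicity.isErgodic_of_atom 0 M.exists_pow_singleton_zero_pos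
    (M.tabooMean_ne_top hc hint hdrift)
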